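/- Let $\Lambda$ be a set of edge labels, finite or, more generally, equipped with a fixed (primitive recursive) encoding by natural numbers. A graph $G$ consists of finite sets $V_G$ of nodes and $E_G$ of edges, source and target maps $E_G\to V_G$ and a labelling $E_G\to\Lambda$; a morphism $\varphi\colon G\to H$ is a pair of maps $V_G\to V_H$, $E_G\to E_H$ that preserves sources, targets and labels. For $n\ge 1$ let $\mathcal M_n=\{0,1,\dots,n,m\}$ with $0\le 1\le\dots\le n\le m$ and with addition of numbers, where a sum is $m$ as soon as it exceeds $n$ or one of the summands is $m$. Let $\mathcal B^n(G)$ be the set of functions $V_G\sqcup E_G\to\mathcal M_n$, ordered pointwise; for $\varphi\colon G\to H$ and $a\in\mathcal B^n(G)$ let $\mathcal B^n_\varphi(a)(y)=\sum_{\varphi(x)=y}a(x)$ (sum in $\mathcal M_n$), and let $s_G\in\mathcal B^n(G)$ be constantly $1$. A multiply annotated type graph $T[M]$ over $\mathcal B^n$ is a graph $T$ with a finite set $M\subseteq\mathcal B^n(T)\times\mathcal B^n(T)$ such that $\ell\le u$ for all $(\ell,u)\in M$. Its language $\mathcal L(T[M])$ is the class of all graphs $G$ for which there are a morphism $\varphi\colon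 G\to T$ and a pair $(\ell,u)\in M$ with $\ell\le\mathcal B^n_\varphi(s_G)\le u$; and $\mathcal L(T[M])^{\le k}$ is the class of those $G\in\mathcal L(T[M])$ that have pathwidth at most $k$, that is, a path decomposition all of whose bags have at most $k+1$ nodes. Then the language inclusion problem for graph languages of bounded pathwidth characterized by multiply annotated type graphs is decidable: there is an algorithm that, given $n\ge 1$, $k\in\mathbb N$ and (finite descriptions of) two multiply annotated type graphs $T_1[M_1]$ and $T_2[M_2]$ over $\mathcal B^n$, decides whether $$\mathcal L(T_1[M_1])^{\le k}\subseteq\mathcal L(T_2[M_2])^{\le k}.$$ -/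

import Mathlib

/-- A finite directed multigraph whose edges are labelled in `Λ`. -/
structure LGraph (Λ : Type*) where
  V : Type
  E : Type
  [fintypeV : Fintype V]
  [fintypeE : Fintype E]
  src : E → V
  tgt : E → V
  lab : E → Λ

attribute [instance] LGraph.fintypeV LGraph.fintypeE

namespace LGraph

variable {Λ : Type*}

/-- Graph morphisms: they preserve sources, targets and labels. -/
structure Hom (G H : LGraph Λ) where
  onV : G.V → H.V
  onE : G.E → H.E
  src_eq : ∀ e, H.src (onE e) = onV (G.src e)
  tgt_eq : ∀ e, H.tgt (onE e) = onV (G.tgt e)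
  lab_eq : ∀ e, H.lab (onE e) = G.lab e

/-- The items of a graph: its nodes and its edges (disjoint union). -/
abbrev Item (G : LGraph Λ) : Type := G.V ⊕ G.E

/-- The action of a morphism on items. -/
def Hom.onItem {G H : LGraph Λ} (φ : Hom G H) : G.Item → H.Item := Sum.map φ.onV φ.onE

/-- A path decomposition of `G`: a finite sequence of bags of nodes such that every node lies in a
bag, the two endpoints of every edge lie in a common bag, and the bags containing a given node are
consecutive. -/
structure PathDecomposition (G : LGraph Λ) where
  length : ℕ
  bag : Fin length → Finset G.V
  node_mem : ∀ v, ∃ i, v ∈ bag i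
  edge_mem : ∀ e, ∃ i, G.src e ∈ bag i ∧ G.tgt e ∈ bag i
  consecutive : ∀ i j l v, i ≤ j → j ≤ l → v ∈ bag i → v ∈ bag l → v ∈ bag j

/-- `G` has pathwidth at most `k`: it has a path decomposition all of whose bags have at most
`k + 1` elements. -/
def PathwidthLE (G : LGraph Λ) (k : ℕ) : Prop :=
  ∃ D : G.PathDecomposition, ∀ i, (D.bag i).card ≤ k + 1

end LGraph

/-- The set `{0, 1, …, n, m}` of multiplicities, ordered by `0 ≤ 1 ≤ … ≤ n ≤ m`. The element `m`
(many) is represented by the number `n + 1`. -/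
def Mult (n : ℕ) : Type := Fin (n + 2)

namespace Mult

variable {n : ℕ}

instance : LinearOrder (Mult n) := inferInstanceAs (LinearOrder (Fin (n + 2)))

/-- The number representing a multiplicity (`n + 1` for `m`). -/
def toNat (a : Mult n) : ℕ := Fin.val a

theorem toNat_injective : Function.Injective (toNat (n := n)) :=
  fun _ _ h => Fin.ext h

theorem toNat_lt (a : Mult n) : a.toNat < n + 2 := Fin.isLt a

/-- The multiplicity of a number: every number larger than `n` becomes `m`. -/
def ofNat (n x : ℕ) : Mult n := ⟨min x (n + 1), by omega⟩

theorem toNat_ofNat (x : ℕ) : (ofNat n x).toNat = min x (n + 1) := rfl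

instance : Zero (Mult n) := ⟨ofNat n 0⟩
instance : One (Mult n) := ⟨ofNat n 1⟩

/-- Addition, with the result `m` as soon as the sum exceeds `n`. -/
instance : Add (Mult n) := ⟨fun a b => ofNat n (a.toNat + b.toNat)⟩

theorem toNat_zero : (0 : Mult n).toNat = 0 := Nat.zero_min _

theorem toNat_add (a b : Mult n) : (a + b).toNat = min (a.toNat + b.toNat) (n + 1) := rfl

instance : AddCommMonoid (Mult n) where
  add_assoc a b c := toNat_injective (by simp only [toNat_add]; omega)
  zero_add a := toNat_injective (by have := toNat_lt a; simp only [toNat_add, toNat_zero]; omega)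
  add_zero a := toNat_injective (by have := toNat_lt a; simp only [toNat_add, toNat_zero]; omega)
  add_comm a b := toNat_injective (by simp only [toNat_add]; omega)
  nsmul := nsmulRec

end Mult

namespace LGraph

variable {Λ : Type*}

/-- The multiplicities `ℬⁿ(G)` of a graph, with the pointwise order. -/
abbrev Annot (n : ℕ) (G : LGraph Λ) : Type := G.Item → Mult n

/-- The standard multiplicity of a graph, constantly `1`. -/
def stdAnnot (n : ℕ) (G : LGraph Λ) : G.Annot n := fun _ => 1

open Classical in
/-- The action `ℬⁿ_φ` of a morphism on multiplicities: sum over the preimages of an item. -/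
noncomputable def Hom.mapAnnot {n : ℕ} {G H : LGraph Λ} (φ : Hom G H) (a : G.Annot n) :
    H.Annot n :=
  fun y => ∑ x with φ.onItem x = y, a x

end LGraph

/-- A multiply annotated graph `T[M]` over `ℬⁿ`. -/
structure MultAnnotGraph (Λ : Type*) (n : ℕ) where
  graph : LGraph Λ
  bounds : Finset (graph.Annot n × graph.Annot n)
  lower_le_upper : ∀ p ∈ bounds, p.1 ≤ p.2

namespace MultAnnotGraph

variable {Λ : Type*} {n : ℕ}

/-- The language `ℒ(T[M])`: the graphs `G` with a morphism `φ : G → T` such that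
`ℓ ≤ ℬⁿ_φ(s_G) ≤ u` for some `(ℓ, u) ∈ M`. -/
def language (T : MultAnnotGraph Λ n) : Set (LGraph Λ) :=
  {G | ∃ φ : G.Hom T.graph, ∃ p ∈ T.bounds,
    p.1 ≤ φ.mapAnnot (G.stdAnnot n) ∧ φ.mapAnnot (G.stdAnnot n) ≤ p.2}

/-- `ℒ(T[M])^{≤ k}`: the graphs of pathwidth at most `k` in `ℒ(T[M])`. -/
def languageLE (T : MultAnnotGraph Λ n) (k : ℕ) : Set (LGraph Λ) :=
  {G | G ∈ T.language ∧ G.PathwidthLE k}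

end MultAnnotGraph

/-- Finite descriptions of annotations: the list of the values at the nodes and the list of the
values at the edges. -/
abbrev AnnotCode : Type := List ℕ × List ℕ

/-- Finite descriptions of multiply annotated graphs: the number of nodes, the list of the edges
as triples (source, label, target), and the list of the pairs of annotations. -/
abbrev MultAnnotGraphCode (Λ : Type*) := ℕ × List (ℕ × Λ × ℕ) × List (AnnotCode × AnnotCode)

namespace MultAnnotGraph

variable {Λ : Type*} {n : ℕ}

/-- The description of an annotation with respect to numberings of the nodes and the edges. -/
def annotCode {G : LGraph Λ} {v e : ℕ} (ν : Fin v ≃ G.V) (ε : Fin e ≃ G.E) (a : G.Annot n) :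
    AnnotCode :=
  (List.ofFn fun i => (a (Sum.inl (ν i))).toNat, List.ofFn fun j => (a (Sum.inr (ε j))).toNat)

/-- `c` describes `T[M]` with respect to some numberings of the nodes and the edges. -/
def IsCode (T : MultAnnotGraph Λ n) (c : MultAnnotGraphCode Λ) : Prop :=
  ∃ (v e : ℕ) (ν : Fin v ≃ T.graph.V) (ε : Fin e ≃ T.graph.E),
    c.1 = v ∧
    c.2.1 = List.ofFn (fun j => ((ν.symm (T.graph.src (ε j)) : ℕ), T.graph.lab (ε j),
      (ν.symm (T.graph.tgt (ε j)) : ℕ))) ∧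
    ∀ x, x ∈ c.2.2 ↔ ∃ p ∈ T.bounds, x = (annotCode ν ε p.1, annotCode ν ε p.2)

/-- Every multiply annotated graph has a description. -/
theorem exists_isCode (T : MultAnnotGraph Λ n) : ∃ c, T.IsCode c := by
  classical
  let ν := (Fintype.equivFin T.graph.V).symm
  let ε := (Fintype.equivFin T.graph.E).symm
  refine ⟨(_, _, T.bounds.toList.map fun p => (annotCode ν ε p.1, annotCode ν ε p.2)),
    _, _, ν, ε, rfl, rfl, fun x => ?_⟩
  simp [eq_comm]

end MultAnnotGraph

/-!
The decision procedure rests on an encoding of the graphs of pathwidth at most `k` by words over a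
finite alphabet. A word is a program for a machine with `k + 1` slots, each of which holds at most
one node: an operation either puts a new node into a slot or adds an edge between the nodes in two
slots. The contents of the slots at the successive times are the bags of a path decomposition
(`LGraph.Builds.pathwidthLE`), and conversely, following a path decomposition with bags of at most
`k + 1` nodes, every graph of pathwidth at most `k` is built by some word
(`LGraph.exists_builds_of_pathwidthLE`).

While a word is read, a morphism from the graph under construction to a type graph `T` need only be
remembered through a configuration: the images of the nodes in the slots, and the number of
preimages of every item of `T`, counted in the finite monoid `Mult n`. There are finitely many
configurations, and the set of those that come from some morphism is computed letter by letter, as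
in the subset construction (`LGraph.Builds.evalWord_eq`). Whether the graph belongs to the language
of `T[M]` can be read off from this set. Hence the inclusion holds if and only if no word is accepted
for the first type graph and rejected for the second
(`MultAnnotGraph.languageLE_subset_iff`). A shortest counterexample does not repeat a pair of sets of
configurations and uses only labels of the first type graph, so its length is bounded
(`MultAnnotGraph.languageLE_subset_iff_short`).

It remains to carry out the construction on the finite descriptions of the type graphs: the list of
the pairs of sets of configurations reachable by words of bounded length is primitive recursive, and
so is the comparison of the two acceptance conditions (`MultAnnotGraph.inclusionCode_iff`,
`PrimrecPred.inclusionCode`).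
-/

namespace LGraph

variable {Λ : Type*}

/-! ### Words that build graphs -/

/-- An operation on a graph under construction, with `ι` the set of slots, each of which may hold a
node: `(none, i, _)` creates a new node and puts it into slot `i`, and `(some l, i, j)` creates an
edge with label `l` from the node in slot `i` to the node in slot `j`. The second slot of a node
operation is ignored. -/
abbrev BuildOp (Λ : Type*) (ι : Type) : Type _ := Option Λ × ι × ι

/-- `G.Builds w A B s`: the word `w`, whose head is the operation performed last, builds the
subgraph of `G` with node set `A` and edge set `B` and leaves the slots with contents `s`. -/
inductive Builds (G : LGraph Λ) {k : ℕ} : List (BuildOp Λ (Fin (k + 1))) → Set G.V → Set G.E →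
    (Fin (k + 1) → Option G.V) → Prop
  | nil : Builds G [] ∅ ∅ fun _ => none
  | node {w A B s} (i j : Fin (k + 1)) (v : G.V) : v ∉ A → Builds G w A B s →
      Builds G ((none, i, j) :: w) (insert v A) B (Function.update s i (some v))
  | edge {w A B s} (i j : Fin (k + 1)) (e : G.E) : e ∉ B → s i = some (G.src e) →
      s j = some (G.tgt e) → Builds G w A B s →
      Builds G ((some (G.lab e), i, j) :: w) A (insert e B) s

namespace Builds

variable {G : LGraph Λ} {k : ℕ} {w : List (BuildOp Λ (Fin (k + 1)))} {A : Set G.V} {B : Set G.E}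
  {s : Fin (k + 1) → Option G.V}

theorem mem_of_slot (h : G.Builds w A B s) {i : Fin (k + 1)} {v : G.V} (hv : s i = some v) :
    v ∈ A := by
  induction h generalizing i v with
  | nil => simp at hv
  | node i' j' v' _ _ ih =>
    by_cases hi : i = i'
    · subst hi
      simp only [Function.update_self, Option.some.injEq] at hv
      exact hv ▸ Set.mem_insert _ _
    · rw [Function.update_of_ne hi] at hv
      exact Set.mem_insert_of_mem _ (ih hv)
  | edge _ _ _ _ _ _ _ ih => exact ih hv

theorem endpoints_mem (h : G.Builds w A B s) {e : G.E} (he : e ∈ B) :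
    G.src e ∈ A ∧ G.tgt e ∈ A := by
  induction h with
  | nil => simp at he
  | node _ _ _ _ _ ih => exact ⟨Set.mem_insert_of_mem _ (ih he).1, Set.mem_insert_of_mem _ (ih he).2⟩
  | edge i j e' _ hi hj hb ih =>
    rcases he with rfl | he
    · exact ⟨hb.mem_of_slot hi, hb.mem_of_slot hj⟩
    · exact ih he

theorem map (h : G.Builds w A B s) {H : LGraph Λ} (φ : G.Hom H) (hV : Function.Injective φ.onV)
    (hE : Function.Injective φ.onE) :
    H.Builds w (φ.onV '' A) (φ.onE '' B) fun i => (s i).map φ.onV := by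
  induction h with
  | nil => simpa using Builds.nil
  | node i j v hv _ ih =>
    have := Builds.node i j (φ.onV v) (by simpa [hV.eq_iff] using hv) ih
    rw [← Set.image_insert_eq] at this
    convert this using 1
    funext i'
    by_cases hi : i' = i
    · subst hi; simp
    · simp [hi]
  | edge i j e he hi hj _ ih =>
    have := Builds.edge i j (φ.onE e) (by simpa [hE.eq_iff] using he)
      (by rw [hi, φ.src_eq]; rfl) (by rw [hj, φ.tgt_eq]; rfl) ih
    rwa [← Set.image_insert_eq, φ.lab_eq] at this

end Builds

/-! ### Runs of words over a type graph -/

/-- The data kept about a partial morphism into `T`: the images of the nodes in the slots, and the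
number of preimages of every item of `T`. -/
abbrev Config (T : LGraph Λ) (n k : ℕ) : Type := (Fin (k + 1) → Option T.V) × T.Annot n

open Classical in
/-- The configurations that arise from `c` when the item created by an operation is mapped to some
item of `T`. -/
noncomputable def stepConfig (T : LGraph Λ) {n k : ℕ} :
    BuildOp Λ (Fin (k + 1)) → T.Config n k → Set (T.Config n k)
  | (none, i, _), c =>
      {c' | ∃ t : T.V, c' = (Function.update c.1 i (some t), c.2 + Pi.single (Sum.inl t) 1)}
  | (some l, i, j), c =>
      {c' | ∃ e : T.E, c.1 i = some (T.src e) ∧ c.1 j = some (T.tgt e) ∧ T.lab e = l ∧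
        c' = (c.1, c.2 + Pi.single (Sum.inr e) 1)}

/-- The subset construction for `stepConfig`. -/
noncomputable def stepSet (T : LGraph Λ) {n k : ℕ} (o : BuildOp Λ (Fin (k + 1)))
    (S : Set (T.Config n k)) : Set (T.Config n k) :=
  {c' | ∃ c ∈ S, c' ∈ T.stepConfig o c}

/-- The configurations reachable by a word, whose head is the last operation. -/
noncomputable def evalWord (T : LGraph Λ) (n : ℕ) {k : ℕ} (w : List (BuildOp Λ (Fin (k + 1)))) :
    Set (T.Config n k) :=
  w.foldr T.stepSet {(fun _ => none, 0)}

/-- A morphism to `T` from the subgraph of `G` with node set `A` and edge set `B`, as a pair of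
functions that are defined exactly on `A` and on `B`. -/
structure IsPartialHom (G T : LGraph Λ) (A : Set G.V) (B : Set G.E) (f : G.V → Option T.V)
    (g : G.E → Option T.E) : Prop where
  isSome_onV : ∀ v, (f v).isSome ↔ v ∈ A
  isSome_onE : ∀ e, (g e).isSome ↔ e ∈ B
  map_edge : ∀ e e', g e = some e' →
    f (G.src e) = some (T.src e') ∧ f (G.tgt e) = some (T.tgt e') ∧ T.lab e' = G.lab e

/-- The number of preimages of every item of `T` under a partial morphism. -/
noncomputable def partialCount {G T : LGraph Λ} (n : ℕ) (f : G.V → Option T.V)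
    (g : G.E → Option T.E) : T.Annot n :=
  Sum.elim (fun t => Mult.ofNat n {v | f v = some t}.ncard)
    fun t => Mult.ofNat n {e | g e = some t}.ncard

theorem _root_.Mult.ofNat_add (n a b : ℕ) :
    Mult.ofNat n (a + b) = Mult.ofNat n a + Mult.ofNat n b :=
  Mult.toNat_injective (by simp only [Mult.toNat_add, Mult.toNat_ofNat]; omega)

theorem _root_.Mult.ofNat_zero (n : ℕ) : Mult.ofNat n 0 = 0 := rfl

open Classical in
theorem _root_.Set.ncard_update_some {α β : Type*} [Finite α] {f : α → Option β} {a : α}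
    (ha : f a = none) (b b' : β) :
    {x | Function.update f a (some b) x = some b'}.ncard =
      {x | f x = some b'}.ncard + if b' = b then 1 else 0 := by
  split_ifs with h
  · subst h
    rw [← Set.ncard_insert_of_notMem (a := a) (by simp [ha])]
    congr 1
    ext x
    by_cases hx : x = a
    · subst hx; simp
    · simp [hx]
  · rw [add_zero]
    congr 1
    ext x
    by_cases hx : x = a
    · subst hx; simp [ha, Ne.symm h]
    · simp [hx]

open Classical in
theorem partialCount_update_node {G T : LGraph Λ} {n : ℕ} {f : G.V → Option T.V}
    (g : G.E → Option T.E) {v : G.V} (hv : f v = none) (t : T.V) :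
    partialCount n (Function.update f v (some t)) g =
      partialCount n f g + Pi.single (Sum.inl t) 1 := by
  funext y
  rcases y with y | y
  · simp only [partialCount, Sum.elim_inl, Pi.add_apply, Set.ncard_update_some hv, Mult.ofNat_add,
      Pi.single_apply, Sum.inl.injEq]
    split_ifs <;> rfl
  · simp [partialCount]

open Classical in
theorem partialCount_update_edge {G T : LGraph Λ} {n : ℕ} (f : G.V → Option T.V)
    {g : G.E → Option T.E} {e : G.E} (he : g e = none) (t : T.E) :
    partialCount n f (Function.update g e (some t)) =
      partialCount n f g + Pi.single (Sum.inr t) 1 := by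
  funext y
  rcases y with y | y
  · simp [partialCount]
  · simp only [partialCount, Sum.elim_inr, Pi.add_apply, Set.ncard_update_some he, Mult.ofNat_add,
      Pi.single_apply, Sum.inr.injEq]
    split_ifs <;> rfl

theorem IsPartialHom.eq_none_onV {G T : LGraph Λ} {A : Set G.V} {B : Set G.E} {f : G.V → Option T.V}
    {g : G.E → Option T.E} (h : G.IsPartialHom T A B f g) {v : G.V} (hv : v ∉ A) : f v = none := by
  rwa [← h.isSome_onV, Option.not_isSome_iff_eq_none] at hv

theorem IsPartialHom.eq_none_onE {G T : LGraph Λ} {A : Set G.V} {B : Set G.E} {f : G.V → Option T.V}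
    {g : G.E → Option T.E} (h : G.IsPartialHom T A B f g) {e : G.E} (he : e ∉ B) : g e = none := by
  rwa [← h.isSome_onE, Option.not_isSome_iff_eq_none] at he

open Classical in
theorem IsPartialHom.insert_node {G T : LGraph Λ} {A : Set G.V} {B : Set G.E}
    {f : G.V → Option T.V} {g : G.E → Option T.E} (h : G.IsPartialHom T A B f g) {v : G.V}
    (hv : v ∉ A) (t : T.V) :
    G.IsPartialHom T (insert v A) B (Function.update f v (some t)) g where
  isSome_onV x := by
    by_cases hx : x = v
    · subst hx; simp
    · simp [hx, h.isSome_onV]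
  isSome_onE := h.isSome_onE
  map_edge e e' he := by
    obtain ⟨h1, h2, h3⟩ := h.map_edge e e' he
    have hn := h.eq_none_onV hv
    rw [Function.update_of_ne (by rintro rfl; simp [hn] at h1),
      Function.update_of_ne (by rintro rfl; simp [hn] at h2)]
    exact ⟨h1, h2, h3⟩

open Classical in
theorem IsPartialHom.erase_node {G T : LGraph Λ} {A : Set G.V} {B : Set G.E}
    {f : G.V → Option T.V} {g : G.E → Option T.E} {v : G.V}
    (h : G.IsPartialHom T (insert v A) B f g) (hv : v ∉ A)
    (hB : ∀ e ∈ B, G.src e ∈ A ∧ G.tgt e ∈ A) :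
    G.IsPartialHom T A B (Function.update f v none) g where
  isSome_onV x := by
    by_cases hx : x = v
    · subst hx; simp [hv]
    · simp [hx, h.isSome_onV]
  isSome_onE := h.isSome_onE
  map_edge e e' he := by
    obtain ⟨hs, ht⟩ := hB e ((h.isSome_onE e).1 (by simp [he]))
    rw [Function.update_of_ne (by rintro rfl; exact hv hs),
      Function.update_of_ne (by rintro rfl; exact hv ht)]
    exact h.map_edge e e' he

open Classical in
theorem IsPartialHom.insert_edge {G T : LGraph Λ} {A : Set G.V} {B : Set G.E}
    {f : G.V → Option T.V} {g : G.E → Option T.E} (h : G.IsPartialHom T A B f g) {e : G.E} {t : T.E}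
    (hs : f (G.src e) = some (T.src t)) (ht : f (G.tgt e) = some (T.tgt t))
    (hl : T.lab t = G.lab e) :
    G.IsPartialHom T A (insert e B) f (Function.update g e (some t)) where
  isSome_onV := h.isSome_onV
  isSome_onE x := by
    by_cases hx : x = e
    · subst hx; simp
    · simp [hx, h.isSome_onE]
  map_edge x x' hx' := by
    by_cases hx : x = e
    · subst hx
      simp only [Function.update_self, Option.some.injEq] at hx'
      subst hx'
      exact ⟨hs, ht, hl⟩
    · rw [Function.update_of_ne hx] at hx'
      exact h.map_edge x x' hx'

open Classical in
theorem IsPartialHom.erase_edge {G T : LGraph Λ} {A : Set G.V} {B : Set G.E}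
    {f : G.V → Option T.V} {g : G.E → Option T.E} {e : G.E}
    (h : G.IsPartialHom T A (insert e B) f g) (he : e ∉ B) :
    G.IsPartialHom T A B f (Function.update g e none) where
  isSome_onV := h.isSome_onV
  isSome_onE x := by
    by_cases hx : x = e
    · subst hx; simp [he]
    · simp [hx, h.isSome_onE]
  map_edge x x' hx' := by
    by_cases hx : x = e
    · subst hx; simp at hx'
    · rw [Function.update_of_ne hx] at hx'
      exact h.map_edge x x' hx'

open Classical in
/-- The configurations reachable by a word are those of the partial morphisms defined on the
subgraph that the word builds. This is where forgetting all nodes outside the slots is harmless: a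
new edge has its endpoints in the slots. -/
theorem Builds.evalWord_eq {G : LGraph Λ} {k : ℕ} {w : List (BuildOp Λ (Fin (k + 1)))}
    {A : Set G.V} {B : Set G.E} {s : Fin (k + 1) → Option G.V} (h : G.Builds w A B s)
    (T : LGraph Λ) (n : ℕ) :
    T.evalWord n w = {c | ∃ f g, G.IsPartialHom T A B f g ∧
      c = (fun i => (s i).bind f, partialCount n f g)} := by
  induction h with
  | nil =>
    ext c
    simp only [evalWord, List.foldr_nil, Set.mem_singleton_iff, Set.mem_ofPred_eq]
    constructor
    · rintro rfl
      refine ⟨fun _ => none, fun _ => none, ⟨by simp, by simp, by simp⟩, ?_⟩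
      refine Prod.ext (by simp) (funext fun y => ?_)
      rcases y with y | y <;> simp [partialCount, Mult.ofNat_zero]
    · rintro ⟨f, g, hfg, rfl⟩
      have hf v : f v = none := hfg.eq_none_onV (Set.notMem_empty v)
      have hg e : g e = none := hfg.eq_none_onE (Set.notMem_empty e)
      refine Prod.ext (by simp) (funext fun y => ?_)
      rcases y with y | y <;> simp [partialCount, hf, hg, Mult.ofNat_zero]
  | @node w A B s i j v hv hb ih =>
    have key (f : G.V → Option T.V) (t : T.V) :
        (fun i' => (Function.update s i (some v) i').bind (Function.update f v (some t))) =
          Function.update (fun i' => (s i').bind f) i (some t) := by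
      funext i'
      by_cases hi : i' = i
      · subst hi; simp
      · rw [Function.update_of_ne hi, Function.update_of_ne hi]
        rcases hs : s i' with _ | x
        · rfl
        · have : x ≠ v := by rintro rfl; exact hv (hb.mem_of_slot hs)
          simp [this]
    ext c
    change (∃ c₀ ∈ T.evalWord n w, ∃ t, c = _) ↔ _
    rw [ih]
    constructor
    · rintro ⟨_, ⟨f, g, hfg, rfl⟩, t, rfl⟩
      refine ⟨_, g, hfg.insert_node hv t, ?_⟩
      rw [key, partialCount_update_node g (hfg.eq_none_onV hv)]
    · rintro ⟨f, g, hfg, rfl⟩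
      obtain ⟨t, ht⟩ := Option.isSome_iff_exists.1 ((hfg.isSome_onV v).2 (Set.mem_insert _ _))
      have hfg' := hfg.erase_node hv fun e he => hb.endpoints_mem he
      refine ⟨_, ⟨_, g, hfg', rfl⟩, t, ?_⟩
      rw [← key, ← partialCount_update_node g (hfg'.eq_none_onV hv), Function.update_idem,
        ← ht, Function.update_eq_self]
  | @edge w A B s i j e he hi hj hb ih =>
    ext c
    change (∃ c₀ ∈ T.evalWord n w, ∃ t, _ ∧ _ ∧ _ ∧ c = _) ↔ _
    rw [ih]
    constructor
    · rintro ⟨_, ⟨f, g, hfg, rfl⟩, t, h1, h2, h3, rfl⟩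
      simp only [hi, hj, Option.bind_some] at h1 h2
      refine ⟨f, _, hfg.insert_edge h1 h2 h3, ?_⟩
      rw [partialCount_update_edge f (hfg.eq_none_onE he)]
    · rintro ⟨f, g, hfg, rfl⟩
      obtain ⟨t, ht⟩ := Option.isSome_iff_exists.1 ((hfg.isSome_onE e).2 (Set.mem_insert _ _))
      have hfg' := hfg.erase_edge he
      obtain ⟨h1, h2, h3⟩ := hfg.map_edge e t ht
      refine ⟨_, ⟨f, _, hfg', rfl⟩, t, by simpa [hi] using h1, by simpa [hj] using h2, h3, ?_⟩
      rw [← partialCount_update_edge f (hfg'.eq_none_onE he), Function.update_idem,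
        ← ht, Function.update_eq_self]

/-- Morphisms are the partial morphisms that are defined everywhere. -/
theorem exists_hom_mapAnnot_iff {G T : LGraph Λ} {n : ℕ} (a : T.Annot n) :
    (∃ φ : G.Hom T, φ.mapAnnot (G.stdAnnot n) = a) ↔
      ∃ f g, G.IsPartialHom T Set.univ Set.univ f g ∧ partialCount n f g = a := by
  classical
  have key (φ : G.Hom T) : φ.mapAnnot (G.stdAnnot n) =
      partialCount n (fun v => some (φ.onV v)) (fun e => some (φ.onE e)) := by
    have sum_one {α : Type} (s : Finset α) : ∑ _x ∈ s, (1 : Mult n) = Mult.ofNat n s.card := by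
      induction s using Finset.induction_on with
      | empty => rfl
      | insert x s hx ih =>
        rw [Finset.sum_insert hx, ih, Finset.card_insert_of_notMem hx, Mult.ofNat_add, add_comm]
        rfl
    funext y
    simp only [Hom.mapAnnot, stdAnnot]
    rw [sum_one]
    rcases y with y | y
    · simp only [partialCount, Sum.elim_inl, Option.some.injEq]
      congr 1
      rw [← Set.ncard_image_of_injective _ (Sum.inl_injective (β := G.E)), ← Set.ncard_coe_finset,
        Finset.coe_filter_univ]
      congr 1
      ext (x | x) <;> simp [Hom.onItem]
    · simp only [partialCount, Sum.elim_inr, Option.some.injEq]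
      congr 1
      rw [← Set.ncard_image_of_injective _ (Sum.inr_injective (α := G.V)), ← Set.ncard_coe_finset,
        Finset.coe_filter_univ]
      congr 1
      ext (x | x) <;> simp [Hom.onItem]
  constructor
  · rintro ⟨φ, rfl⟩
    refine ⟨_, _, ⟨by simp, by simp, fun e e' he => ?_⟩, (key φ).symm⟩
    cases he
    exact ⟨by rw [φ.src_eq], by rw [φ.tgt_eq], φ.lab_eq e⟩
  · rintro ⟨f, g, hfg, rfl⟩
    choose f' hf using fun v => Option.isSome_iff_exists.1 ((hfg.isSome_onV v).2 (Set.mem_univ v))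
    choose g' hg using fun e => Option.isSome_iff_exists.1 ((hfg.isSome_onE e).2 (Set.mem_univ e))
    refine ⟨⟨f', g', fun e => ?_, fun e => ?_, fun e => (hfg.map_edge e _ (hg e)).2.2⟩, ?_⟩
    · have := (hfg.map_edge e _ (hg e)).1
      rw [hf] at this
      exact (Option.some.inj this).symm
    · have := (hfg.map_edge e _ (hg e)).2.1
      rw [hf] at this
      exact (Option.some.inj this).symm
    · rw [key]
      congr 1 <;> funext x
      · exact (hf x).symm
      · exact (hg x).symm

/-! ### Words and path decompositions -/

/-- `G` with an additional isolated node `none`. -/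
def addNode (G : LGraph Λ) : LGraph Λ where
  V := Option G.V
  E := G.E
  src e := some (G.src e)
  tgt e := some (G.tgt e)
  lab := G.lab

/-- `G` with an additional edge `none` from `u` to `v` with label `l`. -/
def addEdge (G : LGraph Λ) (u v : G.V) (l : Λ) : LGraph Λ where
  V := G.V
  E := Option G.E
  src e := e.elim u G.src
  tgt e := e.elim v G.tgt
  lab e := e.elim l G.lab

/-- A word with a run over some type graph builds a graph: along a run, edges are only created
between slots that hold nodes. -/
theorem exists_builds_of_nonempty {T : LGraph Λ} {n k : ℕ} {w : List (BuildOp Λ (Fin (k + 1)))}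
    (hw : (T.evalWord n w).Nonempty) :
    ∃ (G : LGraph Λ) (s : _), G.Builds w Set.univ Set.univ s := by
  induction w with
  | nil =>
    refine ⟨⟨Empty, Empty, Empty.elim, Empty.elim, Empty.elim⟩, fun _ => none, ?_⟩
    convert Builds.nil <;> exact (Set.eq_empty_of_isEmpty _)
  | cons o w ih =>
    obtain ⟨c', c, hc, hc'⟩ := hw
    obtain ⟨G, s, h⟩ := ih ⟨c, hc⟩
    obtain ⟨_ | l, i, j⟩ := o
    · have := h.map (H := G.addNode) ⟨some, id, fun _ => rfl, fun _ => rfl, fun _ => rfl⟩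
        (Option.some_injective _) Function.injective_id
      have := Builds.node (G := G.addNode) i j none (by rintro ⟨_, _, h⟩; cases h) this
      refine ⟨G.addNode, Function.update (fun i' => (s i').map some) i (some none), ?_⟩
      convert this using 1
      · ext x
        rcases x with _ | x
        · exact iff_of_true trivial (Or.inl rfl)
        · exact iff_of_true trivial (Or.inr ⟨x, trivial, rfl⟩)
      · exact (Set.image_univ_of_surjective Function.surjective_id).symm
    · obtain ⟨t, hi, hj, -⟩ := hc'
      change c ∈ T.evalWord n w at hc
      rw [h.evalWord_eq] at hc
      obtain ⟨f, g, -, rfl⟩ := hc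
      obtain ⟨u, hu, -⟩ := Option.bind_eq_some_iff.1 hi
      obtain ⟨v, hv, -⟩ := Option.bind_eq_some_iff.1 hj
      have := h.map (H := G.addEdge u v l) ⟨id, some, fun _ => rfl, fun _ => rfl, fun _ => rfl⟩
        Function.injective_id (Option.some_injective _)
      have := Builds.edge (G := G.addEdge u v l) i j none (by rintro ⟨_, _, h⟩; cases h)
        (by rw [hu]; rfl) (by rw [hv]; rfl) this
      refine ⟨G.addEdge u v l, fun i' => (s i').map id, ?_⟩
      convert this using 1
      · rfl
      · exact (Set.image_univ_of_surjective Function.surjective_id).symm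
      · ext (x : Option G.E)
        rcases x with _ | x
        · exact iff_of_true trivial (Or.inl rfl)
        · exact iff_of_true trivial (Or.inr ⟨x, trivial, rfl⟩)
      · rfl

open Classical in
/-- The nodes in the slots. -/
noncomputable def slotBag {V : Type} {k : ℕ} (s : Fin (k + 1) → Option V) : Finset V :=
  (Finset.univ.image s).eraseNone

theorem mem_slotBag {V : Type} {k : ℕ} {s : Fin (k + 1) → Option V} {v : V} :
    v ∈ slotBag s ↔ ∃ i, s i = some v := by
  simp [slotBag]

theorem card_slotBag_le {V : Type} {k : ℕ} (s : Fin (k + 1) → Option V) :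
    (slotBag s).card ≤ k + 1 := by
  classical
  calc (slotBag s).card ≤ (Finset.univ.image s).card := Finset.card_eraseNone_le _
    _ ≤ (Finset.univ : Finset (Fin (k + 1))).card := Finset.card_image_le
    _ = k + 1 := by simp

/-- The contents of the slots at the successive times are the bags of a path decomposition. -/
theorem Builds.exists_bags {G : LGraph Λ} {k : ℕ} {w : List (BuildOp Λ (Fin (k + 1)))}
    {A : Set G.V} {B : Set G.E} {s : Fin (k + 1) → Option G.V} (h : G.Builds w A B s) :
    ∃ (m : ℕ) (bag : ℕ → Finset G.V), (∀ v ∈ A, ∃ i ≤ m, v ∈ bag i) ∧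
      (∀ e ∈ B, ∃ i ≤ m, G.src e ∈ bag i ∧ G.tgt e ∈ bag i) ∧
      (∀ i j l v, i ≤ j → j ≤ l → l ≤ m → v ∈ bag i → v ∈ bag l → v ∈ bag j) ∧
      (∀ i ≤ m, (bag i).card ≤ k + 1 ∧ ∀ v ∈ bag i, v ∈ A) ∧ bag m = slotBag s := by
  induction h with
  | nil =>
    refine ⟨0, fun _ => ∅, by simp, by simp, by simp, by simp, ?_⟩
    ext v
    simp [mem_slotBag]
  | @node w A B s i j v hv hb ih =>
    obtain ⟨m, bag, hA, hB, hC, hk, hs⟩ := ih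
    obtain ⟨bag', old, new⟩ : ∃ bag' : ℕ → Finset G.V, (∀ t ≤ m, bag' t = bag t) ∧
        ∀ t, ¬ t ≤ m → bag' t = slotBag (Function.update s i (some v)) :=
      ⟨fun t => if t ≤ m then bag t else slotBag (Function.update s i (some v)),
        fun t ht => if_pos ht, fun t ht => if_neg ht⟩
    refine ⟨m + 1, bag', ?_, ?_, ?_, ?_, new _ (by omega)⟩
    · rintro x (rfl | hx)
      · exact ⟨m + 1, le_rfl, new (m + 1) (by omega) ▸ mem_slotBag.2 ⟨i, by simp⟩⟩
      · obtain ⟨t, ht, hx⟩ := hA x hx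
        exact ⟨t, by omega, by rwa [old t ht]⟩
    · intro e he
      obtain ⟨t, ht, hx⟩ := hB e he
      exact ⟨t, by omega, by rwa [old t ht]⟩
    · intro a b c x hab hbc hc hxa hxc
      by_cases hcm : c ≤ m
      · rw [old _ (by omega)] at hxa hxc ⊢
        exact hC a b c x hab hbc hcm hxa hxc
      by_cases hbm : b ≤ m
      · rw [old _ (by omega)] at hxa ⊢
        rw [new c hcm, mem_slotBag] at hxc
        obtain ⟨i', hi'⟩ := hxc
        have hxv : x ≠ v := by rintro rfl; exact hv ((hk a (by omega)).2 _ hxa)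
        have hii : i' ≠ i := by rintro rfl; simp at hi'; exact hxv hi'.symm
        rw [Function.update_of_ne hii] at hi'
        exact hC a b m x hab hbm le_rfl hxa (hs ▸ mem_slotBag.2 ⟨i', hi'⟩)
      · rw [new c hcm] at hxc
        rwa [new b hbm]
    · intro t ht
      by_cases htm : t ≤ m
      · rw [old t htm]
        exact ⟨(hk t htm).1, fun x hx => Set.mem_insert_of_mem _ ((hk t htm).2 x hx)⟩
      · rw [new t htm]
        refine ⟨card_slotBag_le _, fun x hx => ?_⟩
        obtain ⟨i', hi'⟩ := mem_slotBag.1 hx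
        exact (Builds.node i j v hv hb).mem_of_slot hi'
  | @edge w A B s i j e he hi hj hb ih =>
    obtain ⟨m, bag, hA, hB, hC, hk, hs⟩ := ih
    refine ⟨m, bag, hA, ?_, hC, hk, hs⟩
    rintro x (rfl | hx)
    · exact ⟨m, le_rfl, hs ▸ mem_slotBag.2 ⟨i, hi⟩, hs ▸ mem_slotBag.2 ⟨j, hj⟩⟩
    · exact hB x hx

theorem Builds.pathwidthLE {G : LGraph Λ} {k : ℕ} {w : List (BuildOp Λ (Fin (k + 1)))}
    {s : Fin (k + 1) → Option G.V} (h : G.Builds w Set.univ Set.univ s) : G.PathwidthLE k := by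
  obtain ⟨m, bag, hA, hB, hC, hk, -⟩ := h.exists_bags
  refine ⟨⟨m + 1, fun i => bag i, fun v => ?_, fun e => ?_, fun i j l v hij hjl => ?_⟩,
    fun i => (hk i (Nat.lt_succ_iff.1 i.isLt)).1⟩
  · obtain ⟨i, hi, h⟩ := hA v trivial
    exact ⟨⟨i, by omega⟩, h⟩
  · obtain ⟨i, hi, h⟩ := hB e trivial
    exact ⟨⟨i, by omega⟩, h⟩
  · exact hC i j l v hij hjl (Nat.lt_succ_iff.1 l.isLt)

/-- Since a bag has at most `k + 1` nodes, there is room in the slots for all of them. -/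
theorem Builds.exists_add_bag {G : LGraph Λ} {k : ℕ} {w : List (BuildOp Λ (Fin (k + 1)))}
    {A : Set G.V} {B : Set G.E} {s : Fin (k + 1) → Option G.V} (h : G.Builds w A B s)
    {X : Finset G.V} (hX : X.card ≤ k + 1) (hs : ∀ v ∈ X, v ∈ A → ∃ i, s i = some v) :
    ∃ (w' : List (BuildOp Λ (Fin (k + 1)))) (s' : _), G.Builds w' (A ∪ X) B s' ∧
      ∀ v ∈ X, ∃ i, s' i = some v := by
  classical
  suffices ∀ Y ⊆ X, ∃ (w' : List (BuildOp Λ (Fin (k + 1)))) (s' : _), G.Builds w' (A ∪ Y) B s' ∧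
      ∀ v ∈ X, v ∈ A ∪ Y → ∃ i, s' i = some v by
    obtain ⟨w', s', h1, h2⟩ := this X subset_rfl
    exact ⟨w', s', h1, fun v hv => h2 v hv (Or.inr hv)⟩
  intro Y
  induction Y using Finset.induction_on with
  | empty => exact fun _ => ⟨w, s, by simpa using h, by simpa using hs⟩
  | insert y Y _ ih =>
    intro hY
    obtain ⟨w', s', hb, hs'⟩ := ih fun v hv => hY (Finset.mem_insert_of_mem hv)
    by_cases hy : y ∈ A ∪ Y
    · refine ⟨w', s', ?_, ?_⟩ <;>
        rwa [Finset.coe_insert, Set.union_insert, Set.insert_eq_of_mem hy]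
    -- The nodes of `X` present so far do not include `y`, so they occupy at most `k` slots.
    obtain ⟨i, hi⟩ : ∃ i, ∀ v ∈ X, v ∈ A ∪ Y → ∃ i' ≠ i, s' i' = some v := by
      choose! τ hτ using hs'
      have hcard : ((X.erase y).image τ).card < (Finset.univ : Finset (Fin (k + 1))).card := by
        have := Finset.card_erase_lt_of_mem (hY (Finset.mem_insert_self y Y))
        have := Finset.card_image_le (s := X.erase y) (f := τ)
        rw [Finset.card_univ, Fintype.card_fin]
        omega
      obtain ⟨i, -, hi⟩ := Finset.exists_mem_notMem_of_card_lt_card hcard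
      refine ⟨i, fun v hv hvA => ⟨τ v, ?_, hτ v hv hvA⟩⟩
      rintro rfl
      refine hi (Finset.mem_image_of_mem τ (Finset.mem_erase.2 ⟨?_, hv⟩))
      rintro rfl
      exact hy hvA
    refine ⟨(none, i, i) :: w', Function.update s' i (some y), ?_, ?_⟩
    · rw [Finset.coe_insert, Set.union_insert]
      exact Builds.node i i y hy hb
    · rw [Finset.coe_insert, Set.union_insert]
      rintro v hv (rfl | hvA)
      · exact ⟨i, by simp⟩
      · obtain ⟨i', hi', h⟩ := hi v hv hvA
        exact ⟨i', by rwa [Function.update_of_ne hi']⟩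

theorem Builds.exists_add_edges {G : LGraph Λ} {k : ℕ} {w : List (BuildOp Λ (Fin (k + 1)))}
    {A : Set G.V} {B : Set G.E} {s : Fin (k + 1) → Option G.V} (h : G.Builds w A B s)
    (Z : Finset G.E) (hZ : ∀ e ∈ Z, (∃ i, s i = some (G.src e)) ∧ ∃ i, s i = some (G.tgt e)) :
    ∃ w' : List (BuildOp Λ (Fin (k + 1))), G.Builds w' A (B ∪ Z) s := by
  classical
  induction Z using Finset.induction_on with
  | empty => exact ⟨w, by simpa using h⟩
  | insert e Z _ ih =>
    obtain ⟨w', hb⟩ := ih fun e he => hZ e (Finset.mem_insert_of_mem he)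
    rw [Finset.coe_insert, Set.union_insert]
    by_cases he : e ∈ B ∪ Z
    · exact ⟨w', by rwa [Set.insert_eq_of_mem he]⟩
    · obtain ⟨⟨i, hi⟩, j, hj⟩ := hZ e (Finset.mem_insert_self e Z)
      exact ⟨_, Builds.edge i j e he hi hj hb⟩

theorem exists_builds_of_pathwidthLE {G : LGraph Λ} {k : ℕ} (h : G.PathwidthLE k) :
    ∃ (w : List (BuildOp Λ (Fin (k + 1)))) (s : _), G.Builds w Set.univ Set.univ s := by
  classical
  obtain ⟨D, hD⟩ := h
  suffices ∀ m ≤ D.length, ∃ (w : List (BuildOp Λ (Fin (k + 1)))) (s : _),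
      G.Builds w {v | ∃ i : Fin D.length, i < m ∧ v ∈ D.bag i}
        {e | ∃ i : Fin D.length, i < m ∧ G.src e ∈ D.bag i ∧ G.tgt e ∈ D.bag i} s ∧
      ∀ i : Fin D.length, i + 1 = m → ∀ v ∈ D.bag i, ∃ i', s i' = some v by
    obtain ⟨w, s, hb, -⟩ := this _ le_rfl
    refine ⟨w, s, ?_⟩
    convert hb using 1
    · ext v
      simpa using D.node_mem v
    · ext e
      simpa using D.edge_mem e
  intro m
  induction m with
  | zero => exact fun _ => ⟨[], fun _ => none, by simpa using Builds.nil, by simp⟩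
  | succ m ih =>
    intro hm
    obtain ⟨w, s, hb, hs⟩ := ih (by omega)
    obtain ⟨w₁, s₁, hb₁, hs₁⟩ := hb.exists_add_bag (hD ⟨m, hm⟩) (by
      rintro v hv ⟨i, hi, hvi⟩
      exact hs ⟨m - 1, by omega⟩ (by simp; omega) v
        -- A node of the bag that was added before lies in the preceding bag, hence in a slot.
        (D.consecutive i _ ⟨m, hm⟩ v (Fin.mk_le_mk.2 (by omega)) (Fin.mk_le_mk.2 (by omega)) hvi hv))
    obtain ⟨w₂, hb₂⟩ := hb₁.exists_add_edges
      (Finset.univ.filter fun e => G.src e ∈ D.bag ⟨m, hm⟩ ∧ G.tgt e ∈ D.bag ⟨m, hm⟩)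
      (fun e he => by
        simp only [Finset.mem_filter, Finset.mem_univ, true_and] at he
        exact ⟨hs₁ _ he.1, hs₁ _ he.2⟩)
    have split (P : Fin D.length → Prop) :
        (∃ i : Fin D.length, i < m + 1 ∧ P i) ↔ (∃ i : Fin D.length, i < m ∧ P i) ∨ P ⟨m, hm⟩ := by
      constructor
      · rintro ⟨i, hi, h⟩
        rcases Nat.lt_succ_iff_lt_or_eq.1 hi with hi | hi
        · exact Or.inl ⟨i, hi, h⟩
        · exact Or.inr (by convert h; exact hi.symm)
      · rintro (⟨i, hi, h⟩ | h)
        · exact ⟨i, by omega, h⟩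
        · exact ⟨_, by simp, h⟩
    refine ⟨w₂, s₁, ?_, ?_⟩
    · convert hb₂ using 1
      · ext v
        simpa using split fun i => v ∈ D.bag i
      · ext e
        simpa using split fun i => G.src e ∈ D.bag i ∧ G.tgt e ∈ D.bag i
    · intro i hi v hv
      refine hs₁ v ?_
      convert hv
      omega

end LGraph

namespace LGraph

variable {Λ : Type*}

/-! ### Inclusion as a statement about short words -/

/-- A word with a run over `T` contains only labels of `T`. -/
theorem exists_lab_eq_of_nonempty {T : LGraph Λ} {n k : ℕ} {w : List (BuildOp Λ (Fin (k + 1)))}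
    (hw : (T.evalWord n w).Nonempty) {o : BuildOp Λ (Fin (k + 1))} (ho : o ∈ w) {l : Λ}
    (hl : o.1 = some l) : ∃ e, T.lab e = l := by
  induction w with
  | nil => simp at ho
  | cons o' w ih =>
    obtain ⟨c', c, hc, hc'⟩ := hw
    rcases List.mem_cons.1 ho with rfl | ho
    · obtain ⟨_ | l', i, j⟩ := o
      · cases hl
      · cases hl
        obtain ⟨e, -, -, he, -⟩ := hc'
        exact ⟨e, he⟩
    · exact ih ⟨c, hc⟩ ho

end LGraph

namespace MultAnnotGraph

open LGraph

variable {Λ : Type*} {n : ℕ}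

/-- Some configuration in `S` satisfies one of the pairs of bounds. -/
def Accepts (T : MultAnnotGraph Λ n) {k : ℕ} (S : Set (T.graph.Config n k)) : Prop :=
  ∃ c ∈ S, ∃ p ∈ T.bounds, p.1 ≤ c.2 ∧ c.2 ≤ p.2

theorem mem_language_iff_accepts (T : MultAnnotGraph Λ n) {G : LGraph Λ} {k : ℕ}
    {w : List (BuildOp Λ (Fin (k + 1)))} {s : Fin (k + 1) → Option G.V}
    (h : G.Builds w Set.univ Set.univ s) :
    G ∈ T.language ↔ T.Accepts (T.graph.evalWord n w) := by
  rw [h.evalWord_eq]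
  constructor
  · rintro ⟨φ, p, hp, hpl, hpu⟩
    obtain ⟨f, g, hfg, h⟩ := (exists_hom_mapAnnot_iff _).1 ⟨φ, rfl⟩
    rw [← h] at hpl hpu
    exact ⟨_, ⟨f, g, hfg, rfl⟩, p, hp, hpl, hpu⟩
  · rintro ⟨_, ⟨f, g, hfg, rfl⟩, p, hp, hpl, hpu⟩
    obtain ⟨φ, h⟩ := (exists_hom_mapAnnot_iff _).2 ⟨f, g, hfg, rfl⟩
    exact ⟨φ, p, hp, h ▸ hpl, h ▸ hpu⟩

/-- Words represent exactly the graphs of pathwidth at most `k`, so that inclusion is a statement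
about words. -/
theorem languageLE_subset_iff (T₁ T₂ : MultAnnotGraph Λ n) (k : ℕ) :
    T₁.languageLE k ⊆ T₂.languageLE k ↔ ∀ w : List (BuildOp Λ (Fin (k + 1))),
      T₁.Accepts (T₁.graph.evalWord n w) → T₂.Accepts (T₂.graph.evalWord n w) := by
  constructor
  · intro h w hw
    obtain ⟨G, s, hG⟩ := exists_builds_of_nonempty (hw.imp fun _ h => h.1)
    exact (T₂.mem_language_iff_accepts hG).1
      (h ⟨(T₁.mem_language_iff_accepts hG).2 hw, hG.pathwidthLE⟩).1
  · rintro h G ⟨hG, hk⟩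
    obtain ⟨w, s, hw⟩ := exists_builds_of_pathwidthLE hk
    exact ⟨(T₂.mem_language_iff_accepts hw).2 (h w ((T₁.mem_language_iff_accepts hw).1 hG)), hk⟩

end MultAnnotGraph

/-- Every state that a deterministic automaton reaches is reached by a short word over the same
letters: loops can be cut out. -/
theorem exists_short_foldr_eq {α σ : Type*} [Fintype σ] (f : α → σ → σ) (x : σ) (w : List α) :
    ∃ w' : List α, w' ⊆ w ∧ w'.length ≤ Fintype.card σ ∧ w'.foldr f x = w.foldr f x := by
  induction hn : w.length using Nat.strong_induction_on generalizing w with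
  | _ m ih =>
    by_cases hm : Fintype.card σ ≤ m
    · let M : DFA α σ := ⟨fun s a => f a s, x, ∅⟩
      obtain ⟨q, a, b, c, h, -, hb, ha, hbq, -⟩ :=
        M.evalFrom_split (x := w.reverse) (s := x) (by simpa [hn] using hm) rfl
      obtain rfl : w = (a ++ b ++ c).reverse := by rw [← h, List.reverse_reverse]
      have hlen : (a ++ c).reverse.length < m := by
        have := List.length_pos_iff.2 hb
        simp at hn ⊢
        omega
      obtain ⟨w', hw', hl, he⟩ := ih _ hlen _ rfl
      refine ⟨w', fun y hy => ?_, hl, he.trans ?_⟩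
      · have := hw' hy
        simp at this ⊢
        tauto
      · have key (u : List α) : u.reverse.foldr f x = M.evalFrom x u := by
          rw [List.foldr_reverse]; rfl
        rw [key, key, DFA.evalFrom_of_append, ha, DFA.evalFrom_of_append,
          DFA.evalFrom_of_append, ha, hbq]
    · exact ⟨w, List.Subset.refl _, by omega, rfl⟩

namespace MultAnnotGraph

open LGraph

variable {Λ : Type*} {n : ℕ}

/-- The number of pairs of sets of configurations bounds the length of a shortest counterexample, and
the labels of a counterexample occur in the first type graph. -/
theorem languageLE_subset_iff_short (T₁ T₂ : MultAnnotGraph Λ n) (k : ℕ) {N : ℕ}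
    (hN : Nat.card (Set (T₁.graph.Config n k) × Set (T₂.graph.Config n k)) ≤ N)
    [Finite (T₁.graph.Config n k)] [Finite (T₂.graph.Config n k)] :
    T₁.languageLE k ⊆ T₂.languageLE k ↔ ∀ w : List (BuildOp Λ (Fin (k + 1))), w.length ≤ N →
      (∀ o ∈ w, ∀ l, o.1 = some l → ∃ e, T₁.graph.lab e = l) →
      T₁.Accepts (T₁.graph.evalWord n w) → T₂.Accepts (T₂.graph.evalWord n w) := by
  classical
  rw [languageLE_subset_iff]
  refine ⟨fun h w _ _ => h w, fun h w hw => ?_⟩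
  have := Fintype.ofFinite (Set (T₁.graph.Config n k) × Set (T₂.graph.Config n k))
  let step (o : BuildOp Λ (Fin (k + 1)))
      (S : Set (T₁.graph.Config n k) × Set (T₂.graph.Config n k)) :=
    (T₁.graph.stepSet o S.1, T₂.graph.stepSet o S.2)
  have key (u : List (BuildOp Λ (Fin (k + 1)))) :
      u.foldr step ({(fun _ => none, 0)}, {(fun _ => none, 0)}) =
        (T₁.graph.evalWord n u, T₂.graph.evalWord n u) := by
    induction u with
    | nil => rfl
    | cons o u ih => rw [List.foldr_cons, ih]; rfl
  obtain ⟨w', hsub, hlen, heq⟩ :=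
    exists_short_foldr_eq step ({(fun _ => none, 0)}, {(fun _ => none, 0)}) w
  rw [key, key, Prod.mk.injEq] at heq
  rw [← heq.1] at hw
  rw [← heq.2]
  refine h w' (hlen.trans (by rwa [← Nat.card_eq_fintype_card])) (fun o ho l hl => ?_) hw
  exact exists_lab_eq_of_nonempty (hw.imp fun _ h => h.1) ho hl

end MultAnnotGraph

namespace MultAnnotGraph

open LGraph

variable {Λ : Type*}

/-! ### Runs on descriptions -/

/-- Finite descriptions of configurations: the list of the contents of the slots, with `0` for an
empty slot and `t + 1` for node `t`, and the description of the annotation. -/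
abbrev ConfigCode : Type := List ℕ × AnnotCode

/-- The addition of `1` in `Mult n`, on representing numbers. -/
def bump (n a : ℕ) : ℕ := min (a + 1) (n + 1)

/-- The edge with number `q` in the list fits into the slots `i` and `j` and has label `l`. -/
def EdgeFits (E : List (ℕ × Λ × ℕ)) (x : ConfigCode) (l : Λ) (i j q : ℕ) : Prop :=
  E[q]?.map (fun y => (y.1 + 1, y.2.1, y.2.2 + 1)) = some (x.1.getD i 0, l, x.1.getD j 0)

/-- The descriptions of the configurations that arise when a new node is put into slot `i`. -/
def nodeStepCode (n v i : ℕ) (x : ConfigCode) : List ConfigCode :=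
  (List.range v).map fun t => (x.1.set i (t + 1), x.2.1.modify t (bump n), x.2.2)

open Classical in
/-- The descriptions of the configurations that arise when an edge with label `l` is added between
the slots `i` and `j`. -/
noncomputable def edgeStepCode (n : ℕ) (E : List (ℕ × Λ × ℕ)) (l : Λ) (i j : ℕ) (x : ConfigCode) :
    List ConfigCode :=
  (List.range E.length).filterMap fun q =>
    if EdgeFits E x l i j q then some (x.1, x.2.1, x.2.2.modify q (bump n)) else none

/-- `LGraph.stepConfig` on descriptions. -/
noncomputable def stepCode (n : ℕ) (c : MultAnnotGraphCode Λ) (o : BuildOp Λ ℕ) (x : ConfigCode) :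
    List ConfigCode :=
  o.1.elim (nodeStepCode n c.1 o.2.1 x) fun l => edgeStepCode n c.2.1 l o.2.1 o.2.2 x

/-- The description of the configuration before the first operation. -/
def initCode (k : ℕ) (c : MultAnnotGraphCode Λ) : ConfigCode :=
  ((List.range (k + 1)).map fun _ => 0, (List.range c.1).map fun _ => 0,
    (List.range c.2.1.length).map fun _ => 0)

/-- The operations with labels in the graph described by `c`. -/
def opCodes (k : ℕ) (c : MultAnnotGraphCode Λ) : List (BuildOp Λ ℕ) :=
  (none :: c.2.1.map fun y => some y.2.1).flatMap fun l =>
    (List.range (k + 1)).flatMap fun i => (List.range (k + 1)).map fun j => (l, i, j)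

/-- The pairs of sets of configurations reached by the words of length at most `m` in the
operations with labels in the first graph. -/
noncomputable def reachCode (n k : ℕ) (c₁ c₂ : MultAnnotGraphCode Λ) :
    ℕ → List (List ConfigCode × List ConfigCode)
  | 0 => [([initCode k c₁], [initCode k c₂])]
  | m + 1 => reachCode n k c₁ c₂ m ++ (reachCode n k c₁ c₂ m).flatMap fun L =>
      (opCodes k c₁).map fun o => (L.1.flatMap (stepCode n c₁ o), L.2.flatMap (stepCode n c₂ o))

/-- The pointwise order of lists of the same length. -/
def ListLE (a b : List ℕ) : Prop := ∀ i < a.length, a.getD i 0 ≤ b.getD i 0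

/-- `MultAnnotGraph.Accepts` on descriptions. -/
def AcceptsCode (c : MultAnnotGraphCode Λ) (L : List ConfigCode) : Prop :=
  ∃ x ∈ L, ∃ p ∈ c.2.2, (ListLE p.1.1 x.2.1 ∧ ListLE p.1.2 x.2.2) ∧
    (ListLE x.2.1 p.2.1 ∧ ListLE x.2.2 p.2.2)

/-- The number of configurations of the graph described by `c`; see `card_config`. -/
def configBound (n k : ℕ) (c : MultAnnotGraphCode Λ) : ℕ :=
  (c.1 + 1) ^ (k + 1) * (n + 2) ^ (c.1 + c.2.1.length)

/-- The inclusion criterion on descriptions: no short word is a counterexample. The bound on the length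
is the number of pairs of sets of configurations. -/
def InclusionCode (n k : ℕ) (c₁ c₂ : MultAnnotGraphCode Λ) : Prop :=
  ∀ L ∈ reachCode n k c₁ c₂ (2 ^ configBound n k c₁ * 2 ^ configBound n k c₂),
    ¬ AcceptsCode c₁ L.1 ∨ AcceptsCode c₂ L.2

section Correctness

variable {n k v e : ℕ} {T : LGraph Λ} (ν : Fin v ≃ T.V) (ε : Fin e ≃ T.E)

/-- The description of a configuration with respect to numberings of the nodes and the edges. -/
def configCode (c : T.Config n k) : ConfigCode :=
  (List.ofFn fun i => (c.1 i).elim 0 fun t => (ν.symm t : ℕ) + 1, annotCode ν ε c.2)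

/-- `L` lists the descriptions of the elements of `S`. -/
def Represents (S : Set (T.Config n k)) (L : List ConfigCode) : Prop :=
  ∀ x, x ∈ L ↔ ∃ c ∈ S, x = configCode ν ε c

theorem _root_.List.set_ofFn {α : Type*} {m : ℕ} (f : Fin m → α) (i : Fin m) (a : α) :
    (List.ofFn f).set i a = List.ofFn (Function.update f i a) := by
  refine List.ext_getElem (by simp) fun q h _ => ?_
  simp only [List.getElem_set, List.getElem_ofFn, Function.update_apply, Fin.ext_iff, eq_comm]

theorem _root_.List.modify_ofFn {α : Type*} {m : ℕ} (f : Fin m → α) (i : Fin m) (g : α → α) :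
    (List.ofFn f).modify i g = List.ofFn (Function.update f i (g (f i))) := by
  refine List.ext_getElem (by simp) fun q h _ => ?_
  simp only [List.getElem_modify, List.getElem_ofFn, Function.update_apply, Fin.ext_iff]
  split_ifs with h1 h2 h2
  · subst h1; rfl
  · exact absurd h1.symm h2
  · exact absurd h2.symm h1
  · rfl

theorem _root_.Mult.toNat_add_one (a : Mult n) : (a + 1).toNat = bump n a.toNat := by
  have : (1 : Mult n).toNat = min 1 (n + 1) := rfl
  rw [Mult.toNat_add, this, bump]
  omega

open Classical in
theorem annotCode_add_single_node (a : T.Annot n) (t : Fin v) :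
    annotCode ν ε (a + Pi.single (Sum.inl (ν t)) 1) =
      ((annotCode ν ε a).1.modify t (bump n), (annotCode ν ε a).2) := by
  refine Prod.ext ?_ ?_
  · simp only [annotCode, List.modify_ofFn, List.ofFn_inj]
    funext i
    by_cases hi : i = t
    · subst hi; simp [Mult.toNat_add_one]
    · simp [hi]
  · simp [annotCode]

open Classical in
theorem annotCode_add_single_edge (a : T.Annot n) (t : Fin e) :
    annotCode ν ε (a + Pi.single (Sum.inr (ε t)) 1) =
      ((annotCode ν ε a).1, (annotCode ν ε a).2.modify t (bump n)) := by
  refine Prod.ext ?_ ?_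
  · simp [annotCode]
  · simp only [annotCode, List.modify_ofFn, List.ofFn_inj]
    funext i
    by_cases hi : i = t
    · subst hi; simp [Mult.toNat_add_one]
    · simp [hi]

variable {ν ε} {c : MultAnnotGraphCode Λ} (hv : c.1 = v)
  (he : c.2.1 = List.ofFn fun j => ((ν.symm (T.src (ε j)) : ℕ), T.lab (ε j),
    (ν.symm (T.tgt (ε j)) : ℕ)))

include he in
theorem edgeFits_iff (x : T.Config n k) (l : Λ) (i j : Fin (k + 1)) (q : Fin e) :
    EdgeFits c.2.1 (configCode ν ε x) l i j q ↔
      x.1 i = some (T.src (ε q)) ∧ x.1 j = some (T.tgt (ε q)) ∧ T.lab (ε q) = l := by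
  have slot (i : Fin (k + 1)) (t : T.V) :
      (ν.symm t : ℕ) + 1 = ((x.1 i).elim 0 fun t => (ν.symm t : ℕ) + 1) ↔ x.1 i = some t := by
    rcases x.1 i with _ | u
    · simp
    · simp [Fin.val_inj, eq_comm]
  have get (i : Fin (k + 1)) : (configCode ν ε x).1.getD i 0 =
      (x.1 i).elim 0 fun t => (ν.symm t : ℕ) + 1 := by
    simp [configCode, -List.ofFn_succ, Nat.lt_succ_iff.1 i.isLt]
  rw [EdgeFits, he, get, get]
  simp only [List.getElem?_ofFn, q.isLt, dite_true, Option.map_some, Option.some.injEq,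
    Prod.mk.injEq, slot, Fin.eta]
  tauto

include hv he in
theorem mem_stepCode_iff (o : BuildOp Λ (Fin (k + 1))) (x : T.Config n k) (y : ConfigCode) :
    y ∈ stepCode n c (o.1, (o.2.1 : ℕ), (o.2.2 : ℕ)) (configCode ν ε x) ↔
      ∃ x' ∈ T.stepConfig o x, y = configCode ν ε x' := by
  classical
  have hlen : c.2.1.length = e := by rw [he, List.length_ofFn]
  obtain ⟨_ | l, i, j⟩ := o
  · have key (t : Fin v) : configCode ν ε
        ((Function.update x.1 i (some (ν t)), x.2 + Pi.single (Sum.inl (ν t)) 1) : T.Config n k) =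
        ((configCode ν ε x).1.set i (t + 1), (configCode ν ε x).2.1.modify t (bump n),
          (configCode ν ε x).2.2) := by
      refine Prod.ext ?_ (annotCode_add_single_node ν ε x.2 t)
      simp only [configCode, List.set_ofFn, List.ofFn_inj]
      funext i'
      by_cases hi : i' = i
      · subst hi; simp
      · simp [hi]
    simp only [stepCode, nodeStepCode, Option.elim_none, List.mem_map, List.mem_range, hv]
    constructor
    · rintro ⟨t, ht, rfl⟩
      exact ⟨_, ⟨ν ⟨t, ht⟩, rfl⟩, (key ⟨t, ht⟩).symm⟩
    · rintro ⟨_, ⟨t, rfl⟩, rfl⟩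
      obtain ⟨t, rfl⟩ := ν.surjective t
      exact ⟨t, t.isLt, (key t).symm⟩
  · have key (q : Fin e) : configCode ν ε
        ((x.1, x.2 + Pi.single (Sum.inr (ε q)) 1) : T.Config n k) =
        ((configCode ν ε x).1, (configCode ν ε x).2.1,
          (configCode ν ε x).2.2.modify q (bump n)) :=
      Prod.ext rfl (annotCode_add_single_edge ν ε x.2 q)
    simp only [stepCode, edgeStepCode, Option.elim_some, List.mem_filterMap, List.mem_range, hlen,
      Option.ite_none_right_eq_some, Option.some.injEq]
    constructor
    · rintro ⟨q, hq, hfit, rfl⟩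
      obtain ⟨h1, h2, h3⟩ := (edgeFits_iff he x l i j ⟨q, hq⟩).1 hfit
      exact ⟨_, ⟨ε ⟨q, hq⟩, h1, h2, h3, rfl⟩, (key ⟨q, hq⟩).symm⟩
    · rintro ⟨_, ⟨q, h1, h2, h3, rfl⟩, rfl⟩
      obtain ⟨q, rfl⟩ := ε.surjective q
      exact ⟨q, q.isLt, (edgeFits_iff he x l i j q).2 ⟨h1, h2, h3⟩, (key q).symm⟩

include hv he in
theorem represents_init :
    Represents (n := n) (k := k) ν ε {(fun _ => none, 0)} [initCode k c] := by
  have hlen : c.2.1.length = e := by rw [he, List.length_ofFn]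
  intro x
  simp [configCode, initCode, annotCode, hv, hlen, Mult.toNat_zero, List.replicate_succ]

include hv he in
theorem Represents.step {S : Set (T.Config n k)} {L : List ConfigCode} (h : Represents ν ε S L)
    (o : BuildOp Λ (Fin (k + 1))) :
    Represents ν ε (T.stepSet o S) (L.flatMap (stepCode n c (o.1, (o.2.1 : ℕ), (o.2.2 : ℕ)))) := by
  intro y
  simp only [List.mem_flatMap, stepSet, Set.mem_ofPred_eq]
  constructor
  · rintro ⟨x, hx, hy⟩
    obtain ⟨d, hd, rfl⟩ := (h x).1 hx
    obtain ⟨d', hd', rfl⟩ := (mem_stepCode_iff hv he o d y).1 hy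
    exact ⟨d', ⟨d, hd, hd'⟩, rfl⟩
  · rintro ⟨d', ⟨d, hd, hd'⟩, rfl⟩
    exact ⟨_, (h _).2 ⟨d, hd, rfl⟩, (mem_stepCode_iff hv he o d _).2 ⟨d', hd', rfl⟩⟩

theorem listLE_ofFn {m : ℕ} (f g : Fin m → ℕ) :
    ListLE (List.ofFn f) (List.ofFn g) ↔ ∀ i, f i ≤ g i := by
  simp only [ListLE, List.length_ofFn]
  constructor
  · intro h i
    simpa using h i i.isLt
  · intro h i hi
    simpa [hi] using h ⟨i, hi⟩

theorem listLE_annotCode (a b : T.Annot n) :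
    ListLE (annotCode ν ε a).1 (annotCode ν ε b).1 ∧ ListLE (annotCode ν ε a).2 (annotCode ν ε b).2 ↔
      a ≤ b := by
  simp only [annotCode, listLE_ofFn]
  constructor
  · rintro ⟨h1, h2⟩ (y | y)
    · change (a _).toNat ≤ (b _).toNat
      simpa using h1 (ν.symm y)
    · change (a _).toNat ≤ (b _).toNat
      simpa using h2 (ε.symm y)
  · intro h
    exact ⟨fun i => h _, fun i => h _⟩

end Correctness

theorem Represents.accepts_iff {n k v e : ℕ} {T : MultAnnotGraph Λ n} {ν : Fin v ≃ T.graph.V}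
    {ε : Fin e ≃ T.graph.E} {c : MultAnnotGraphCode Λ}
    (hc : ∀ x, x ∈ c.2.2 ↔ ∃ p ∈ T.bounds, x = (annotCode ν ε p.1, annotCode ν ε p.2))
    {S : Set (T.graph.Config n k)} {L : List ConfigCode} (h : Represents ν ε S L) :
    AcceptsCode c L ↔ T.Accepts S := by
  constructor
  · rintro ⟨x, hx, p, hp, h1, h2⟩
    obtain ⟨d, hd, rfl⟩ := (h x).1 hx
    obtain ⟨p, hp', rfl⟩ := (hc p).1 hp
    exact ⟨d, hd, p, hp', (listLE_annotCode _ _).1 h1, (listLE_annotCode _ _).1 h2⟩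
  · rintro ⟨d, hd, p, hp, h1, h2⟩
    exact ⟨_, (h _).2 ⟨d, hd, rfl⟩, _, (hc _).2 ⟨p, hp, rfl⟩, (listLE_annotCode _ _).2 h1,
      (listLE_annotCode _ _).2 h2⟩

theorem card_config {n k v e : ℕ} {T : LGraph Λ} (ν : Fin v ≃ T.V) (ε : Fin e ≃ T.E) :
    Finite (T.Config n k) ∧
      Nat.card (T.Config n k) = (v + 1) ^ (k + 1) * (n + 2) ^ (v + e) := by
  classical
  let _ : Fintype (Mult n) := Fin.fintype (n + 2)
  have hM : Fintype.card (Mult n) = n + 2 := Fintype.card_fin _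
  refine ⟨inferInstance, ?_⟩
  rw [Nat.card_eq_fintype_card, Fintype.card_prod, Fintype.card_fun, Fintype.card_fun,
    Fintype.card_option, Fintype.card_sum, hM, ← Fintype.card_congr ν, ← Fintype.card_congr ε]
  simp

theorem mem_opCodes_iff {k : ℕ} {c : MultAnnotGraphCode Λ} {o : BuildOp Λ ℕ} :
    o ∈ opCodes k c ↔ (∀ l, o.1 = some l → ∃ y ∈ c.2.1, y.2.1 = l) ∧ o.2.1 < k + 1 ∧
      o.2.2 < k + 1 := by
  obtain ⟨_ | l, i, j⟩ := o <;> simp [opCodes, -Order.lt_add_one_iff]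

/-- The criterion on descriptions is correct: the lists in `reachCode` represent the sets of
configurations reached by short words. -/
theorem inclusionCode_iff {n k : ℕ} {T₁ T₂ : MultAnnotGraph Λ n} {c₁ c₂ : MultAnnotGraphCode Λ}
    (h₁ : T₁.IsCode c₁) (h₂ : T₂.IsCode c₂) :
    InclusionCode n k c₁ c₂ ↔ T₁.languageLE k ⊆ T₂.languageLE k := by
  obtain ⟨v₁, e₁, ν₁, ε₁, hv₁, he₁, hb₁⟩ := h₁
  obtain ⟨v₂, e₂, ν₂, ε₂, hv₂, he₂, hb₂⟩ := h₂
  have hop (o : BuildOp Λ (Fin (k + 1))) :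
      (o.1, (o.2.1 : ℕ), (o.2.2 : ℕ)) ∈ opCodes k c₁ ↔
        ∀ l, o.1 = some l → ∃ e, T₁.graph.lab e = l := by
    rw [mem_opCodes_iff, he₁]
    simp only [Fin.is_lt, and_true, List.mem_ofFn]
    refine forall₂_congr fun l _ => ⟨?_, ?_⟩
    · rintro ⟨_, ⟨q, rfl⟩, h⟩
      exact ⟨_, h⟩
    · rintro ⟨q, h⟩
      exact ⟨_, ⟨ε₁.symm q, rfl⟩, by simpa using h⟩
  have reach_of_word (w : List (BuildOp Λ (Fin (k + 1))))
      (hw : ∀ o ∈ w, ∀ l, o.1 = some l → ∃ e, T₁.graph.lab e = l) (m : ℕ) (hm : w.length ≤ m) :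
      ∃ L ∈ reachCode n k c₁ c₂ m, Represents ν₁ ε₁ (T₁.graph.evalWord n w) L.1 ∧
        Represents ν₂ ε₂ (T₂.graph.evalWord n w) L.2 := by
    induction m generalizing w with
    | zero =>
      obtain rfl : w = [] := List.length_eq_zero_iff.1 (by omega)
      exact ⟨_, List.mem_singleton_self _, represents_init hv₁ he₁, represents_init hv₂ he₂⟩
    | succ m ih =>
      rcases w with _ | ⟨o, w⟩
      · obtain ⟨L, hL, h⟩ := ih [] hw (Nat.zero_le _)
        exact ⟨L, List.mem_append_left _ hL, h⟩
      · obtain ⟨L, hL, hL₁, hL₂⟩ := ih w (fun o ho => hw o (List.mem_cons_of_mem _ ho))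
          (by simpa using hm)
        refine ⟨_, List.mem_append_right _ (List.mem_flatMap.2 ⟨L, hL, List.mem_map.2
          ⟨_, (hop o).2 (hw o List.mem_cons_self), rfl⟩⟩),
          hL₁.step hv₁ he₁ o, hL₂.step hv₂ he₂ o⟩
  have word_of_reach (m : ℕ) : ∀ L ∈ reachCode n k c₁ c₂ m,
      ∃ w : List (BuildOp Λ (Fin (k + 1))), Represents ν₁ ε₁ (T₁.graph.evalWord n w) L.1 ∧
        Represents ν₂ ε₂ (T₂.graph.evalWord n w) L.2 := by
    induction m with
    | zero =>
      intro L hL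
      obtain rfl := List.mem_singleton.1 hL
      exact ⟨[], represents_init hv₁ he₁, represents_init hv₂ he₂⟩
    | succ m ih =>
      intro L hL
      rcases List.mem_append.1 hL with hL | hL
      · exact ih L hL
      · obtain ⟨L', hL', hL⟩ := List.mem_flatMap.1 hL
        obtain ⟨⟨l, i, j⟩, ho, rfl⟩ := List.mem_map.1 hL
        obtain ⟨w, h₁, h₂⟩ := ih L' hL'
        obtain ⟨-, hi, hj⟩ := mem_opCodes_iff.1 ho
        exact ⟨(l, ⟨i, hi⟩, ⟨j, hj⟩) :: w, h₁.step hv₁ he₁ (l, ⟨i, hi⟩, ⟨j, hj⟩),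
          h₂.step hv₂ he₂ (l, ⟨i, hi⟩, ⟨j, hj⟩)⟩
  obtain ⟨hf₁, hcard₁⟩ := card_config (n := n) (k := k) ν₁ ε₁
  obtain ⟨hf₂, hcard₂⟩ := card_config (n := n) (k := k) ν₂ ε₂
  have hN : Nat.card (Set (T₁.graph.Config n k) × Set (T₂.graph.Config n k)) ≤
      2 ^ configBound n k c₁ * 2 ^ configBound n k c₂ := by
    have card_set (α : Type) [Finite α] : Nat.card (Set α) = 2 ^ Nat.card α := by
      have := Fintype.ofFinite α
      simp
    rw [Nat.card_prod, card_set, card_set, hcard₁, hcard₂, configBound, configBound, he₁, he₂,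
      List.length_ofFn, List.length_ofFn, hv₁, hv₂]
  rw [languageLE_subset_iff_short T₁ T₂ k hN, InclusionCode]
  constructor
  · intro h w hlen hlab hw
    obtain ⟨L, hL, hL₁, hL₂⟩ := reach_of_word w hlab _ hlen
    rcases h L hL with h | h
    · exact absurd ((hL₁.accepts_iff hb₁).2 hw) h
    · exact (hL₂.accepts_iff hb₂).1 h
  · intro h L hL
    obtain ⟨w, hL₁, hL₂⟩ := word_of_reach _ L hL
    rw [hL₁.accepts_iff hb₁, hL₂.accepts_iff hb₂, ← imp_iff_not_or]
    exact (languageLE_subset_iff T₁ T₂ k).1 ((languageLE_subset_iff_short T₁ T₂ k hN).2 h) w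

end MultAnnotGraph

namespace MultAnnotGraph

open LGraph

variable {Λ : Type*} [Primcodable Λ] {α : Type*} [Primcodable α]

/-! ### Computability -/

open Primrec

theorem _root_.Primrec.nat_pow {f g : α → ℕ} (hf : Primrec f) (hg : Primrec g) :
    Primrec fun a => f a ^ g a :=
  (Primrec₂.unpaired'.1 Nat.Primrec.pow).comp hf hg

theorem primrec_bump : Primrec₂ bump :=
  nat_min.comp (succ.comp snd) (succ.comp fst)

theorem primrec_modify_bump {n i : α → ℕ} {l : α → List ℕ} (hn : Primrec n) (hl : Primrec l)
    (hi : Primrec i) : Primrec fun a => (l a).modify (i a) (bump (n a)) :=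
  (list_modify' primrec_bump).comp hl (pair hi hn)

theorem _root_.PrimrecPred.edgeFits {E : α → List (ℕ × Λ × ℕ)} {x : α → ConfigCode} {l : α → Λ}
    {i j q : α → ℕ} (hE : Primrec E) (hx : Primrec x) (hl : Primrec l) (hi : Primrec i)
    (hj : Primrec j) (hq : Primrec q) :
    PrimrecPred fun a => EdgeFits (E a) (x a) (l a) (i a) (j a) (q a) := by
  have hshift : Primrec fun y : ℕ × Λ × ℕ => (y.1 + 1, y.2.1, y.2.2 + 1) :=
    pair (succ.comp fst) (pair (fst.comp snd) (succ.comp (snd.comp snd)))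
  exact Primrec.eq.comp (option_map (list_getElem?.comp hE hq) (hshift.comp snd).to₂)
    (option_some.comp (pair ((list_getD 0).comp (fst.comp hx) hi)
      (pair hl ((list_getD 0).comp (fst.comp hx) hj))))

theorem primrec_nodeStepCode {n v i : α → ℕ} {x : α → ConfigCode} (hn : Primrec n)
    (hv : Primrec v) (hi : Primrec i) (hx : Primrec x) :
    Primrec fun a => nodeStepCode (n a) (v a) (i a) (x a) := by
  have hset : Primrec fun p : α × ℕ => (x p.1).1.set (i p.1) (p.2 + 1) :=
    list_set.comp (fst.comp (hx.comp fst)) (pair (hi.comp fst) (succ.comp snd))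
  have hmod : Primrec fun p : α × ℕ => (x p.1).2.1.modify p.2 (bump (n p.1)) :=
    primrec_modify_bump (hn.comp fst) (fst.comp (snd.comp (hx.comp fst))) snd
  have hrest : Primrec fun p : α × ℕ => (x p.1).2.2 := snd.comp (snd.comp (hx.comp fst))
  exact list_map (list_range.comp hv) (pair hset (pair hmod hrest)).to₂

theorem primrec_edgeStepCode {n : α → ℕ} {E : α → List (ℕ × Λ × ℕ)} {l : α → Λ} {i j : α → ℕ}
    {x : α → ConfigCode} (hn : Primrec n) (hE : Primrec E) (hl : Primrec l) (hi : Primrec i)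
    (hj : Primrec j) (hx : Primrec x) :
    Primrec fun a => edgeStepCode (n a) (E a) (l a) (i a) (j a) (x a) := by
  classical
  have hfits : PrimrecPred fun p : α × ℕ =>
      EdgeFits (E p.1) (x p.1) (l p.1) (i p.1) (j p.1) p.2 :=
    .edgeFits (hE.comp fst) (hx.comp fst) (hl.comp fst) (hi.comp fst) (hj.comp fst) snd
  have hmod : Primrec fun p : α × ℕ => (x p.1).2.2.modify p.2 (bump (n p.1)) :=
    primrec_modify_bump (hn.comp fst) (snd.comp (snd.comp (hx.comp fst))) snd
  have hslots : Primrec fun p : α × ℕ => (x p.1).1 := fst.comp (hx.comp fst)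
  have hnodes : Primrec fun p : α × ℕ => (x p.1).2.1 := fst.comp (snd.comp (hx.comp fst))
  exact listFilterMap (list_range.comp (list_length.comp hE))
    (Primrec.ite hfits (option_some.comp (pair hslots (pair hnodes hmod))) (const none)).to₂

theorem primrec_stepCode {n : α → ℕ} {c : α → MultAnnotGraphCode Λ} {o : α → BuildOp Λ ℕ}
    {x : α → ConfigCode} (hn : Primrec n) (hc : Primrec c) (ho : Primrec o) (hx : Primrec x) :
    Primrec fun a => stepCode (n a) (c a) (o a) (x a) := by
  have hi : Primrec fun a => (o a).2.1 := fst.comp (snd.comp ho)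
  have hj : Primrec fun a => (o a).2.2 := snd.comp (snd.comp ho)
  have hE : Primrec fun a => (c a).2.1 := fst.comp (snd.comp hc)
  have hnode : Primrec fun a => nodeStepCode (n a) (c a).1 (o a).2.1 (x a) :=
    primrec_nodeStepCode hn (fst.comp hc) hi hx
  have hedge : Primrec fun p : α × Λ =>
      edgeStepCode (n p.1) (c p.1).2.1 p.2 (o p.1).2.1 (o p.1).2.2 (x p.1) :=
    primrec_edgeStepCode (hn.comp fst) (hE.comp fst) snd (hi.comp fst) (hj.comp fst) (hx.comp fst)
  refine (option_casesOn (fst.comp ho) hnode hedge.to₂).of_eq fun a => ?_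
  rw [stepCode]
  cases (o a).1 <;> rfl

theorem primrec_initCode {k : α → ℕ} {c : α → MultAnnotGraphCode Λ} (hk : Primrec k)
    (hc : Primrec c) : Primrec fun a => initCode (k a) (c a) :=
  have zeros {f : α → ℕ} (hf : Primrec f) : Primrec fun a => (List.range (f a)).map fun _ => 0 :=
    list_map (list_range.comp hf) (Primrec₂.const 0)
  pair (zeros (succ.comp hk)) (pair (zeros (fst.comp hc))
    (zeros (list_length.comp (fst.comp (snd.comp hc)))))

theorem primrec_opCodes {k : α → ℕ} {c : α → MultAnnotGraphCode Λ} (hk : Primrec k)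
    (hc : Primrec c) : Primrec fun a => opCodes (k a) (c a) := by
  have hlab : Primrec fun a => none :: (c a).2.1.map fun y => some y.2.1 :=
    list_cons.comp (const none) (list_map (fst.comp (snd.comp hc))
      (option_some.comp (fst.comp (snd.comp snd))).to₂)
  have hrange : Primrec fun a => List.range (k a + 1) := list_range.comp (succ.comp hk)
  have hop : Primrec fun p : ((α × Option Λ) × ℕ) × ℕ => (p.1.1.2, p.1.2, p.2) :=
    pair (snd.comp (fst.comp fst)) (pair (snd.comp fst) snd)
  exact list_flatMap hlab (list_flatMap (hrange.comp fst)
    (list_map (hrange.comp (fst.comp fst)) hop.to₂).to₂).to₂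

theorem primrec_reachCode {n k m : α → ℕ} {c₁ c₂ : α → MultAnnotGraphCode Λ} (hn : Primrec n)
    (hk : Primrec k) (hc₁ : Primrec c₁) (hc₂ : Primrec c₂) (hm : Primrec m) :
    Primrec fun a => reachCode (n a) (k a) (c₁ a) (c₂ a) (m a) := by
  have hinit : Primrec fun a => [([initCode (k a) (c₁ a)], [initCode (k a) (c₂ a)])] :=
    list_cons.comp (pair (list_cons.comp (primrec_initCode hk hc₁) (const []))
      (list_cons.comp (primrec_initCode hk hc₂) (const []))) (const [])
  have hset {c : α → MultAnnotGraphCode Λ} (hc : Primrec c) : Primrec fun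
      p : (α × BuildOp Λ ℕ) × List ConfigCode => p.2.flatMap (stepCode (n p.1.1) (c p.1.1) p.1.2) :=
    list_flatMap snd (primrec_stepCode (hn.comp (fst.comp (fst.comp fst)))
      (hc.comp (fst.comp (fst.comp fst))) (snd.comp (fst.comp fst)) snd).to₂
  have hpair : Primrec fun p : (α × (List ConfigCode × List ConfigCode)) × BuildOp Λ ℕ =>
      (p.1.2.1.flatMap (stepCode (n p.1.1) (c₁ p.1.1) p.2),
        p.1.2.2.flatMap (stepCode (n p.1.1) (c₂ p.1.1) p.2)) :=
    pair ((hset hc₁).comp (pair (pair (fst.comp fst) snd) (fst.comp (snd.comp fst))))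
      ((hset hc₂).comp (pair (pair (fst.comp fst) snd) (snd.comp (snd.comp fst))))
  have hops : Primrec fun p : α × (List ConfigCode × List ConfigCode) =>
      (opCodes (k p.1) (c₁ p.1)).map fun o => (p.2.1.flatMap (stepCode (n p.1) (c₁ p.1) o),
        p.2.2.flatMap (stepCode (n p.1) (c₂ p.1) o)) :=
    list_map (primrec_opCodes (hk.comp fst) (hc₁.comp fst)) hpair.to₂
  have hstep : Primrec fun p : α × ℕ × List (List ConfigCode × List ConfigCode) =>
      p.2.2 ++ p.2.2.flatMap fun L => (opCodes (k p.1) (c₁ p.1)).map fun o =>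
        (L.1.flatMap (stepCode (n p.1) (c₁ p.1) o), L.2.flatMap (stepCode (n p.1) (c₂ p.1) o)) :=
    list_append.comp (snd.comp snd) (list_flatMap (snd.comp snd)
      (hops.comp (pair (fst.comp fst) snd)).to₂)
  refine (nat_rec' hm hinit hstep.to₂).of_eq fun a => ?_
  induction m a with
  | zero => rfl
  | succ m ih => rw [reachCode, ← ih]

theorem _root_.PrimrecPred.listLE {f g : α → List ℕ} (hf : Primrec f) (hg : Primrec g) :
    PrimrecPred fun a => ListLE (f a) (g a) := by
  have h : PrimrecRel fun (i : ℕ) (a : α) => (f a).getD i 0 ≤ (g a).getD i 0 :=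
    nat_le.comp ((list_getD 0).comp (hf.comp snd) fst) ((list_getD 0).comp (hg.comp snd) fst)
  exact (h.forall_mem_list.comp (list_range.comp (list_length.comp hf)) .id).of_eq
    fun a => by simp [ListLE]

theorem _root_.PrimrecPred.acceptsCode {c : α → MultAnnotGraphCode Λ} {L : α → List ConfigCode}
    (hc : Primrec c) (hL : Primrec L) : PrimrecPred fun a => AcceptsCode (c a) (L a) := by
  have hbounds : PrimrecRel fun (p : AnnotCode × AnnotCode) (x : ConfigCode) =>
      (ListLE p.1.1 x.2.1 ∧ ListLE p.1.2 x.2.2) ∧ (ListLE x.2.1 p.2.1 ∧ ListLE x.2.2 p.2.2) := by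
    have hx₁ : Primrec fun p : (AnnotCode × AnnotCode) × ConfigCode => p.2.2.1 :=
      fst.comp (snd.comp snd)
    have hx₂ : Primrec fun p : (AnnotCode × AnnotCode) × ConfigCode => p.2.2.2 :=
      snd.comp (snd.comp snd)
    exact ((PrimrecPred.listLE (fst.comp (fst.comp fst)) hx₁).and
      (.listLE (snd.comp (fst.comp fst)) hx₂)).and
      ((PrimrecPred.listLE hx₁ (fst.comp (snd.comp fst))).and
        (.listLE hx₂ (snd.comp (snd.comp fst))))
  have hconfig : PrimrecRel fun (x : ConfigCode) (a : α) =>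
      ∃ p ∈ (c a).2.2, (ListLE p.1.1 x.2.1 ∧ ListLE p.1.2 x.2.2) ∧
        (ListLE x.2.1 p.2.1 ∧ ListLE x.2.2 p.2.2) :=
    hbounds.exists_mem_list.comp (snd.comp (snd.comp (hc.comp snd))) fst
  exact hconfig.exists_mem_list.comp hL .id

theorem primrec_configBound {n k : α → ℕ} {c : α → MultAnnotGraphCode Λ} (hn : Primrec n)
    (hk : Primrec k) (hc : Primrec c) : Primrec fun a => configBound (n a) (k a) (c a) :=
  nat_mul.comp (nat_pow (succ.comp (fst.comp hc)) (succ.comp hk))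
    (nat_pow (nat_add.comp hn (const 2)) (nat_add.comp (fst.comp hc)
      (list_length.comp (fst.comp (snd.comp hc)))))

theorem _root_.PrimrecPred.inclusionCode {n k : α → ℕ} {c₁ c₂ : α → MultAnnotGraphCode Λ}
    (hn : Primrec n) (hk : Primrec k) (hc₁ : Primrec c₁) (hc₂ : Primrec c₂) :
    PrimrecPred fun a => InclusionCode (n a) (k a) (c₁ a) (c₂ a) := by
  have hcheck : PrimrecRel fun (L : List ConfigCode × List ConfigCode) (a : α) =>
      ¬ AcceptsCode (c₁ a) L.1 ∨ AcceptsCode (c₂ a) L.2 :=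
    (PrimrecPred.acceptsCode (hc₁.comp snd) (fst.comp fst)).not.or
      (.acceptsCode (hc₂.comp snd) (snd.comp fst))
  have hbound : Primrec fun a =>
      2 ^ configBound (n a) (k a) (c₁ a) * 2 ^ configBound (n a) (k a) (c₂ a) :=
    nat_mul.comp (nat_pow (const 2) (primrec_configBound hn hk hc₁))
      (nat_pow (const 2) (primrec_configBound hn hk hc₂))
  exact hcheck.forall_mem_list.comp (primrec_reachCode hn hk hc₁ hc₂ hbound) .id

end MultAnnotGraph

theorem mainTheorem1 {Λ : Type*} [Primcodable Λ] :
    ∃ decide : ℕ × ℕ × MultAnnotGraphCode Λ × MultAnnotGraphCode Λ → Bool,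
      Computable decide ∧
      ∀ (n k : ℕ), 0 < n → ∀ (T₁ T₂ : MultAnnotGraph Λ n) (c₁ c₂ : MultAnnotGraphCode Λ),
        T₁.IsCode c₁ → T₂.IsCode c₂ →
          (decide (n, k, c₁, c₂) = true ↔ T₁.languageLE k ⊆ T₂.languageLE k) := by
  obtain ⟨_, h⟩ : PrimrecPred fun p : ℕ × ℕ × MultAnnotGraphCode Λ × MultAnnotGraphCode Λ =>
      MultAnnotGraph.InclusionCode p.1 p.2.1 p.2.2.1 p.2.2.2 :=
    .inclusionCode .fst (Primrec.fst.comp .snd) (Primrec.fst.comp (Primrec.snd.comp .snd))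
      (Primrec.snd.comp (Primrec.snd.comp .snd))
  refine ⟨_, h.to_comp, fun n k _ T₁ T₂ c₁ c₂ h₁ h₂ => ?_⟩
  rw [decide_eq_true_iff]
  exact MultAnnotGraph.inclusionCode_iff h₁ h₂
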